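/- Let $d\ge 0$ be an integer, let $(\mu_k)_{k\in\mathbb Z}$ be a bi-sequence of Borel probability measures on $\mathbb R^d$, and let $\phi:\mathbb R^d\to\mathbb R^d$ be an invertible linear map. Equip $(\mathbb R^d)^{\mathbb Z}$ with the product topology, let $\tau$ be the continuous linear operator on $(\mathbb R^d)^{\mathbb Z}$ given by $\tau\big((v_k)_{k}\big)=\big(\phi(v_{k-1})\big)_{k}$, and let $\mu=\bigotimes_{k\in\mathbb Z}\mu_k$ be the product probability measure on $(\mathbb R^d)^{\mathbb Z}$. For a Borel probability measure $\nu$ and a continuous linear operator $T$ write $T(\nu)$ for the image of $\nu$ under $T$, and let $*$ denote convolution of probability measures. A probability measure $\nu$ is called symmetric if $\nu(-E)=\nu(E)$ for all Borel sets $E$. Suppose that each $\mu_k$ is symmetric. Then the equation $$\lambda_k=\mu_k*\phi(\lambda_{k-1}),\qquad k\in\mathbb Z, \tag{1}$$ has a solution $(\lambda_k)_{k\in\mathbb Z}$ consisting of Borel probability measures on $\mathbb R^d$ if and only if there is a symmetric Borel probability measure $\lambda$ on $(\mathbb R^d)^{\mathbb Z}$ that is strongly $\tau$-decomposable with co-factor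 $\mu$, that is, $$\lambda=\mu*\tau(\lambda)\qquad\text{and}\qquad \tau^n(\lambda)\to\delta_0 \text{ weakly as } n\to\infty .$$ -/

import Mathlib

open MeasureTheory Filter Topology

noncomputable section

namespace OpDecomp

section General

variable {V : Type*} [AddCommGroup V] [Module ℝ V] [TopologicalSpace V]
  [MeasurableSpace V] [BorelSpace V]

/-- The image `T(ν)` of a Borel probability measure `ν` under a continuous linear operator `T`,
given by `T(ν)(E) = ν (T⁻¹ E)`. -/
def image (T : V →L[ℝ] V) (ν : ProbabilityMeasure V) : ProbabilityMeasure V :=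
  ν.map T.continuous.measurable.aemeasurable

/-- The convolution product of two Borel probability measures. -/
def conv [MeasurableAdd₂ V] (ν₁ ν₂ : ProbabilityMeasure V) : ProbabilityMeasure V :=
  ⟨Measure.conv (ν₁ : Measure V) (ν₂ : Measure V), inferInstance⟩

/-- `ν` is symmetric: the measure `E ↦ ν (-E)` equals `ν`. -/
def IsSymmetric (ν : ProbabilityMeasure V) : Prop :=
  (ν : Measure V).neg = (ν : Measure V)

/-- `ρ` is `T`-decomposable with co-factor `ν`, that is, `ρ = ν * T(ρ)`. -/
def IsDecomposable [MeasurableAdd₂ V] (T : V →L[ℝ] V) (ρ ν : ProbabilityMeasure V) : Prop :=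
  ρ = conv ν (image T ρ)

/-- `ρ` is strongly `T`-decomposable with co-factor `ν`: it is `T`-decomposable with co-factor `ν`
and `Tⁿ(ρ) → δ₀` weakly. -/
def IsStronglyDecomposable [MeasurableAdd₂ V] (T : V →L[ℝ] V)
    (ρ ν : ProbabilityMeasure V) : Prop :=
  IsDecomposable T ρ ν ∧
    Tendsto (fun n : ℕ => image (T ^ n) ρ) atTop (𝓝 (diracProba (0 : V)))

end General

section Sequences

variable {d : ℕ}

/-- The weighted shift `τ (v_k) = (φ (v_{k-1}))` on the space of bi-sequences in `ℝᵈ`, with the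
topology of coordinatewise convergence. -/
def weightedShift (φ : EuclideanSpace ℝ (Fin d) →ₗ[ℝ] EuclideanSpace ℝ (Fin d)) :
    (ℤ → EuclideanSpace ℝ (Fin d)) →L[ℝ] (ℤ → EuclideanSpace ℝ (Fin d)) :=
  ContinuousLinearMap.pi fun k =>
    φ.toContinuousLinearMap.comp (ContinuousLinearMap.proj (k - 1))

/-- The measure on bi-sequences with independent coordinates of laws `μ k`. -/
def productLaw (μ : ℤ → ProbabilityMeasure (EuclideanSpace ℝ (Fin d))) :
    ProbabilityMeasure (ℤ → EuclideanSpace ℝ (Fin d)) :=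
  ⟨Measure.infinitePi fun k => (μ k : Measure (EuclideanSpace ℝ (Fin d))), inferInstance⟩

/-- `(l k)` solves the convolution equation `l k = μ k * φ (l (k - 1))` for all `k ∈ ℤ`. -/
def IsSolution (μ : ℤ → ProbabilityMeasure (EuclideanSpace ℝ (Fin d)))
    (φ : EuclideanSpace ℝ (Fin d) →ₗ[ℝ] EuclideanSpace ℝ (Fin d))
    (l : ℤ → ProbabilityMeasure (EuclideanSpace ℝ (Fin d))) : Prop :=
  ∀ k : ℤ, l k = conv (μ k) (image φ.toContinuousLinearMap (l (k - 1)))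

end Sequences

end OpDecomp

end

namespace OpDecomp

/-! From a solution `l`, a better one is built as the limit of the partial convolutions `μ k * Φ(μ
(k-1)) * ⋯`. By symmetry their characteristic functions are real. Iterating the equation shows that
they divide the characteristic function of `l k`. Near the origin the latter does not vanish, so the
partial products are positive, decreasing in the number of factors and bounded below by a positive
constant. Hence the blocks between `n` and `n + m` tend to `1` uniformly in `m`
(`blocksTendToOne_of_ne_zero`). The doubling inequality carries this from small `t` to every `t`
(`blocksTendToOne`).

The partial products are therefore Cauchy everywhere, and Lévy's continuity theorem gives limit laws
`ρ k`. These are symmetric and solve the equation; letting `m → ∞` in the block estimate gives `Φⁿ(ρ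
(k-n)) → δ₀` (`exists_symmetric_solution`). The product of the `ρ k` is the required law on
bi-sequences, since products commute with convolution and with the shift, and weak convergence to a
point mass can be tested on coordinates. Conversely, the marginals of a decomposable law solve the
equation. -/

lemma re_pos_of_ne_zero_on_segment {E : Type*} [NormedAddCommGroup E] [NormedSpace ℝ E]
    {g : E → ℂ} (hg : Continuous g) (hreal : ∀ t, (g t).im = 0)
    (h0 : g 0 = 1) {t : E} (ht : ∀ s ∈ Set.Icc (0 : ℝ) 1, g (s • t) ≠ 0) : 0 < (g t).re := by
  by_contra! hneg
  have hc : ContinuousOn (fun s : ℝ => (g (s • t)).re) (Set.Icc 0 1) := by fun_prop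
  obtain ⟨s, hs, hs0⟩ := intermediate_value_Icc' zero_le_one hc
    (show (0 : ℝ) ∈ Set.Icc _ _ by simp [h0, hneg])
  exact ht s hs (Complex.ext hs0 (hreal _))

lemma re_charFun_le_one {E : Type*} [NormedAddCommGroup E] [InnerProductSpace ℝ E]
    [MeasurableSpace E] (ν : Measure E) [IsProbabilityMeasure ν] (t : E) :
    (charFun ν t).re ≤ 1 :=
  (Complex.re_le_norm _).trans (norm_charFun_le_one t)

/-! ### Characteristic functions in finite dimension. -/

section CharFun

variable {E : Type*} [NormedAddCommGroup E] [InnerProductSpace ℝ E] [FiniteDimensional ℝ E]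
  [MeasurableSpace E] [BorelSpace E]

lemma ProbabilityMeasure.eq_of_charFun_eq {ν₁ ν₂ : ProbabilityMeasure E}
    (h : ∀ t, charFun (ν₁ : Measure E) t = charFun (ν₂ : Measure E) t) : ν₁ = ν₂ :=
  Subtype.ext (Measure.ext_of_charFun (μ := (ν₁ : Measure E)) (ν := (ν₂ : Measure E)) (funext h))

lemma charFun_conv_coe (ν₁ ν₂ : ProbabilityMeasure E) (t : E) :
    charFun (conv ν₁ ν₂ : Measure E) t = charFun (ν₁ : Measure E) t * charFun (ν₂ : Measure E) t :=
  charFun_conv t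

lemma charFun_image (Φ : E →L[ℝ] E) (ν : ProbabilityMeasure E) (t : E) :
    charFun (image Φ ν : Measure E) t = charFun (ν : Measure E) (Φ.adjoint t) := by
  rw [image, ProbabilityMeasure.toMeasure_map, charFun_apply, charFun_apply,
    integral_map (by fun_prop) (by fun_prop)]
  simp [ContinuousLinearMap.adjoint_inner_right]

lemma charFun_measure_neg (ν : Measure E) (t : E) :
    charFun ν.neg t = starRingEnd ℂ (charFun ν t) := by
  rw [← charFun_neg, Measure.neg, charFun_apply, charFun_apply,
    integral_map (by fun_prop) (by fun_prop)]
  simp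

lemma isSymmetric_iff_conj_charFun (ν : ProbabilityMeasure E) :
    IsSymmetric ν ↔ ∀ t, starRingEnd ℂ (charFun (ν : Measure E) t) = charFun (ν : Measure E) t := by
  constructor
  · intro h t
    rw [← charFun_measure_neg, h]
  · intro h
    have : IsFiniteMeasure (ν : Measure E).neg := by
      unfold Measure.neg; infer_instance
    exact Measure.ext_of_charFun (funext fun t => by rw [charFun_measure_neg, h])

lemma re_charFun (ν : Measure E) [IsProbabilityMeasure ν] (t : E) :
    (charFun ν t).re = ∫ x, Real.cos (inner ℝ x t) ∂ν := by
  rw [charFun_apply]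
  have hint : Integrable (fun x => Complex.exp (inner ℝ x t * Complex.I)) ν :=
    (integrable_const (1 : ℝ)).mono (by fun_prop) (by simp [Complex.norm_exp_ofReal_mul_I])
  have h := integral_re hint
  simp only [RCLike.re_eq_complex_re] at h
  rw [← h]
  simp [Complex.exp_ofReal_mul_I_re]

/-- The doubling inequality for characteristic functions. -/
lemma one_sub_re_charFun_two_smul_le (ν : Measure E) [IsProbabilityMeasure ν] (t : E) :
    1 - (charFun ν ((2 : ℝ) • t)).re ≤ 4 * (1 - (charFun ν t).re) := by
  have hi (u : E) : Integrable (fun x => Real.cos (inner ℝ x u)) ν :=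
    (integrable_const (1 : ℝ)).mono (by fun_prop) (by simp [Real.abs_cos_le_one])
  have h (u : E) : 1 - (charFun ν u).re = ∫ x, (1 - Real.cos (inner ℝ x u)) ∂ν := by
    rw [re_charFun, integral_sub (integrable_const _) (hi u)]
    simp
  rw [h, h, ← integral_const_mul]
  refine integral_mono ((integrable_const _).sub (hi _))
    (((integrable_const _).sub (hi _)).const_mul _) fun x => ?_
  simp only [inner_smul_right, Real.cos_two_mul]
  -- With `c = cos ⟨x, t⟩`, the difference of the two sides is `4(1 - c) - (2 - 2c²) = 2(1 - c)²`.
  nlinarith [sq_nonneg (Real.cos (inner ℝ x t) - 1)]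

/-- Continuity of the limit at `0` forces tightness; any subsequential weak limit then has
characteristic function `f`. -/
lemma ProbabilityMeasure.exists_charFun_eq_of_tendsto {ν : ℕ → ProbabilityMeasure E} {f : E → ℂ}
    (hf : ContinuousAt f 0)
    (h : ∀ t, Tendsto (fun n => charFun (ν n : Measure E) t) atTop (𝓝 (f t))) :
    ∃ ρ : ProbabilityMeasure E, ∀ t, charFun (ρ : Measure E) t = f t := by
  have htight := isTightMeasureSet_of_tendsto_charFun hf h
  have hcomp : IsCompact (closure (Set.range ν)) := by
    refine isCompact_closure_of_isTightMeasureSet ?_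
    convert htight using 1
    ext m
    simp
  obtain ⟨ρ, -, θ, hθ, hρ⟩ := hcomp.tendsto_subseq fun n => subset_closure (Set.mem_range_self n)
  refine ⟨ρ, fun t => ?_⟩
  exact tendsto_nhds_unique (ProbabilityMeasure.tendsto_iff_tendsto_charFun.1 hρ t)
    ((h t).comp hθ.tendsto_atTop)

end CharFun

/-! ### Partial convolutions and their limits. -/

section PartialConv

variable {E : Type*} [NormedAddCommGroup E] [InnerProductSpace ℝ E] [FiniteDimensional ℝ E]
  [MeasurableSpace E] [BorelSpace E]

/-- The convolution `μ k * Φ(μ (k-1)) * ⋯ * Φⁿ⁻¹(μ (k-n+1))`. -/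
noncomputable def partialConv (μ : ℤ → ProbabilityMeasure E) (Φ : E →L[ℝ] E) :
    ℕ → ℤ → ProbabilityMeasure E
  | 0, _ => diracProba 0
  | n + 1, k => conv (μ k) (image Φ (partialConv μ Φ n (k - 1)))

variable {μ l : ℤ → ProbabilityMeasure E} {Φ : E →L[ℝ] E}

lemma charFun_partialConv_zero (k : ℤ) (t : E) :
    charFun (partialConv μ Φ 0 k : Measure E) t = 1 := by
  simp [partialConv, diracProba]

lemma charFun_partialConv_succ (n : ℕ) (k : ℤ) (t : E) :
    charFun (partialConv μ Φ (n + 1) k : Measure E) t =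
      charFun (μ k : Measure E) t *
        charFun (partialConv μ Φ n (k - 1) : Measure E) (Φ.adjoint t) := by
  rw [partialConv, charFun_conv_coe, charFun_image]

lemma charFun_partialConv_add (n m : ℕ) (k : ℤ) (t : E) :
    charFun (partialConv μ Φ (n + m) k : Measure E) t =
      charFun (partialConv μ Φ n k : Measure E) t *
        charFun (partialConv μ Φ m (k - n) : Measure E) ((Φ.adjoint ^ n) t) := by
  induction n generalizing k t with
  | zero => simp [charFun_partialConv_zero]
  | succ n ih =>
    rw [add_right_comm, charFun_partialConv_succ, charFun_partialConv_succ, ih, pow_succ, mul_assoc,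
      Nat.cast_succ, add_comm (n : ℤ) 1, ← sub_sub]
    rfl

/-- Iterating the equation `n` times exhibits the partial convolution as a factor of `l k`, so its
characteristic function has no zeros beyond those of `l k`. -/
lemma charFun_eq_partialConv_mul
    (hl : ∀ k, l k = conv (μ k) (image Φ (l (k - 1)))) (n : ℕ) (k : ℤ) (t : E) :
    charFun (l k : Measure E) t = charFun (partialConv μ Φ n k : Measure E) t *
      charFun (l (k - n) : Measure E) ((Φ.adjoint ^ n) t) := by
  induction n generalizing k t with
  | zero => simp [charFun_partialConv_zero]
  | succ n ih =>
    rw [hl k, charFun_conv_coe, charFun_image, charFun_partialConv_succ, ih, pow_succ, mul_assoc,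
      Nat.cast_succ, add_comm (n : ℤ) 1, ← sub_sub]
    rfl

lemma conj_charFun_partialConv (hμ : ∀ k, IsSymmetric (μ k)) (n : ℕ) (k : ℤ) (t : E) :
    starRingEnd ℂ (charFun (partialConv μ Φ n k : Measure E) t) =
      charFun (partialConv μ Φ n k : Measure E) t := by
  induction n generalizing k t with
  | zero => simp [charFun_partialConv_zero]
  | succ n ih =>
    rw [charFun_partialConv_succ, map_mul, ih, (isSymmetric_iff_conj_charFun _).1 (hμ k)]

lemma ofReal_re_charFun_partialConv (hμ : ∀ k, IsSymmetric (μ k)) (n : ℕ) (k : ℤ) (t : E) :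
    ((charFun (partialConv μ Φ n k : Measure E) t).re : ℂ) =
      charFun (partialConv μ Φ n k : Measure E) t :=
  Complex.conj_eq_iff_re.1 (conj_charFun_partialConv hμ n k t)

lemma re_charFun_partialConv_add (hμ : ∀ k, IsSymmetric (μ k)) (n m : ℕ) (k : ℤ) (t : E) :
    (charFun (partialConv μ Φ (n + m) k : Measure E) t).re =
      (charFun (partialConv μ Φ n k : Measure E) t).re *
        (charFun (partialConv μ Φ m (k - n) : Measure E) ((Φ.adjoint ^ n) t)).re := by
  rw [charFun_partialConv_add, ← ofReal_re_charFun_partialConv hμ n k t, Complex.re_ofReal_mul,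
    Complex.ofReal_re]

/-- The real part of the characteristic function of a partial convolution dominates the modulus of
that of a solution, as long as the latter does not vanish on the segment from the origin. -/
lemma norm_charFun_le_re_partialConv (hμ : ∀ k, IsSymmetric (μ k))
    (hl : ∀ k, l k = conv (μ k) (image Φ (l (k - 1)))) (k : ℤ) {t : E}
    (ht : ∀ s ∈ Set.Icc (0 : ℝ) 1, charFun (l k : Measure E) (s • t) ≠ 0) (n : ℕ) :
    ‖charFun (l k : Measure E) t‖ ≤ (charFun (partialConv μ Φ n k : Measure E) t).re := by
  have hpos : 0 < (charFun (partialConv μ Φ n k : Measure E) t).re := by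
    refine re_pos_of_ne_zero_on_segment continuous_charFun
      (fun u => Complex.conj_eq_iff_im.1 (conj_charFun_partialConv hμ n k u)) (by simp) ?_
    intro s hs h0
    exact ht s hs (by rw [charFun_eq_partialConv_mul hl n, h0, zero_mul])
  rw [charFun_eq_partialConv_mul hl n, norm_mul, ← ofReal_re_charFun_partialConv hμ n k t,
    Complex.norm_real, Real.norm_of_nonneg hpos.le, Complex.ofReal_re]
  exact mul_le_of_le_one_right hpos.le (norm_charFun_le_one _)

/-- The characteristic functions of the blocks between `n` and `n + m` tend to `1` at `t` as
`n → ∞`, uniformly in `m`. -/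
def BlocksTendToOne (μ : ℤ → ProbabilityMeasure E) (Φ : E →L[ℝ] E) (k : ℤ) (t : E) : Prop :=
  ∀ ε > 0, ∃ N : ℕ, ∀ n ≥ N, ∀ m : ℕ,
    1 - (charFun (partialConv μ Φ m (k - n) : Measure E) ((Φ.adjoint ^ n) t)).re ≤ ε

lemma BlocksTendToOne.two_smul {k : ℤ} {t : E} (h : BlocksTendToOne μ Φ k t) :
    BlocksTendToOne μ Φ k ((2 : ℝ) • t) := by
  intro ε hε
  obtain ⟨N, hN⟩ := h (ε / 4) (by positivity)
  refine ⟨N, fun n hn m => ?_⟩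
  rw [map_smul]
  have := one_sub_re_charFun_two_smul_le
    (partialConv μ Φ m (k - n) : Measure E) ((Φ.adjoint ^ n) t)
  linarith [hN n hn m]

/-- The real sequence `f` is antitone and bounded below by `c > 0`, hence Cauchy; each block is a
ratio `f (n + m) / f n`. -/
lemma blocksTendToOne_of_ne_zero (hμ : ∀ k, IsSymmetric (μ k))
    (hl : ∀ k, l k = conv (μ k) (image Φ (l (k - 1)))) (k : ℤ) {t : E}
    (ht : ∀ s ∈ Set.Icc (0 : ℝ) 1, charFun (l k : Measure E) (s • t) ≠ 0) :
    BlocksTendToOne μ Φ k t := by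
  set f : ℕ → ℝ := fun n => (charFun (partialConv μ Φ n k : Measure E) t).re with hf
  set c := ‖charFun (l k : Measure E) t‖
  have hc : 0 < c := norm_pos_iff.2 (by simpa using ht 1 (by simp))
  have hcf (n : ℕ) : c ≤ f n := norm_charFun_le_re_partialConv hμ hl k ht n
  have hanti : Antitone f := antitone_nat_of_succ_le fun n => by
    rw [hf]
    simp only
    rw [re_charFun_partialConv_add hμ]
    exact mul_le_of_le_one_right (hc.le.trans (hcf n)) (re_charFun_le_one _ _)
  have hcauchy := (tendsto_atTop_ciInf hanti ⟨c, by rintro _ ⟨n, rfl⟩; exact hcf n⟩).cauchySeq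
  intro ε hε
  -- With `g` the block value, `c (1 - g) ≤ f n (1 - g) = f n - f (n + m) ≤ c ε`, and `c` cancels.
  obtain ⟨N, hN⟩ := Metric.cauchySeq_iff.1 hcauchy (c * ε) (by positivity)
  refine ⟨N, fun n hn m => ?_⟩
  have h1 := (le_abs_self _).trans (hN n hn (n + m) (by omega)).le
  have h2 : f (n + m) = f n *
      (charFun (partialConv μ Φ m (k - n) : Measure E) ((Φ.adjoint ^ n) t)).re :=
    re_charFun_partialConv_add hμ n m k t
  rw [h2] at h1
  have h3 := re_charFun_le_one (partialConv μ Φ m (k - n) : Measure E) ((Φ.adjoint ^ n) t)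
  have h4 := mul_le_mul_of_nonneg_right (hcf n) (sub_nonneg.2 h3)
  exact le_of_mul_le_mul_left (by linarith) hc

lemma exists_pos_forall_ne_zero (ν : ProbabilityMeasure E) :
    ∃ δ > 0, ∀ t : E, ‖t‖ < δ → ∀ s ∈ Set.Icc (0 : ℝ) 1, charFun (ν : Measure E) (s • t) ≠ 0 := by
  have h : ∀ᶠ t in 𝓝 (0 : E), charFun (ν : Measure E) t ≠ 0 :=
    continuous_charFun.continuousAt.eventually_ne (by simp)
  obtain ⟨δ, hδ, hball⟩ := Metric.eventually_nhds_iff.1 h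
  refine ⟨δ, hδ, fun t ht s hs => hball ?_⟩
  rw [dist_zero_right, norm_smul, Real.norm_of_nonneg hs.1]
  exact (mul_le_of_le_one_left (norm_nonneg t) hs.2).trans_lt ht

/-- Nonvanishing is only known on a ball of radius `δ`; each doubling of the argument enlarges the
admissible ball by a factor `2`, until it contains `t`. -/
lemma blocksTendToOne (hμ : ∀ k, IsSymmetric (μ k))
    (hl : ∀ k, l k = conv (μ k) (image Φ (l (k - 1)))) (k : ℤ) (t : E) :
    BlocksTendToOne μ Φ k t := by
  obtain ⟨δ, hδ, hne⟩ := exists_pos_forall_ne_zero (l k)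
  have hind (j : ℕ) : ∀ u : E, ‖u‖ < 2 ^ j * δ → BlocksTendToOne μ Φ k u := by
    induction j with
    | zero => exact fun u hu => blocksTendToOne_of_ne_zero hμ hl k (hne u (by simpa using hu))
    | succ j ih =>
      intro u hu
      have := (ih ((2 : ℝ)⁻¹ • u) (by
        rw [norm_smul, norm_inv, Real.norm_ofNat]
        rw [pow_succ] at hu
        linarith)).two_smul
      rwa [smul_inv_smul₀ two_ne_zero] at this
  obtain ⟨j, hj⟩ := pow_unbounded_of_one_lt (‖t‖ / δ) one_lt_two
  exact hind j t ((div_lt_iff₀ hδ).1 hj)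

lemma exists_tendsto_charFun_partialConv (hμ : ∀ k, IsSymmetric (μ k))
    (hl : ∀ k, l k = conv (μ k) (image Φ (l (k - 1)))) (k : ℤ) (t : E) :
    ∃ z : ℝ, Tendsto (fun n => (charFun (partialConv μ Φ n k : Measure E) t).re) atTop (𝓝 z) := by
  refine cauchySeq_tendsto_of_complete (Metric.cauchySeq_iff'.2 fun ε hε => ?_)
  obtain ⟨N, hN⟩ := blocksTendToOne hμ hl k t (ε / 2) (by positivity)
  refine ⟨N, fun n hn => ?_⟩
  obtain ⟨m, rfl⟩ := Nat.exists_eq_add_of_le hn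
  have h1 := hN N le_rfl m
  set g := (charFun (partialConv μ Φ m (k - N) : Measure E) ((Φ.adjoint ^ N) t)).re
  have h2 : g ≤ 1 := re_charFun_le_one _ _
  have h3 : |(charFun (partialConv μ Φ N k : Measure E) t).re| ≤ 1 :=
    (Complex.abs_re_le_norm _).trans (norm_charFun_le_one t)
  rw [dist_comm, Real.dist_eq, re_charFun_partialConv_add hμ, ← mul_one_sub, abs_mul,
    abs_of_nonneg (sub_nonneg.2 h2)]
  exact (mul_le_of_le_one_left (sub_nonneg.2 h2) h3).trans_lt (by linarith)

/-- The limit laws of the partial convolutions. -/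
lemma exists_tendsto_partialConv (hμ : ∀ k, IsSymmetric (μ k))
    (hl : ∀ k, l k = conv (μ k) (image Φ (l (k - 1)))) (k : ℤ) :
    ∃ ρ : ProbabilityMeasure E, Tendsto (fun n => partialConv μ Φ n k) atTop (𝓝 ρ) := by
  choose z hz using exists_tendsto_charFun_partialConv hμ hl k
  have hz' (t : E) : Tendsto (fun n => charFun (partialConv μ Φ n k : Measure E) t) atTop
      (𝓝 (z t : ℂ)) := by
    refine ((Complex.continuous_ofReal.tendsto _).comp (hz t)).congr fun n => ?_
    exact ofReal_re_charFun_partialConv hμ n k t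
  have hz_le (t : E) : z t ≤ 1 :=
    le_of_tendsto (hz t) (Eventually.of_forall fun n => re_charFun_le_one _ _)
  have hz0 : z 0 = 1 := tendsto_nhds_unique (hz 0) (by simp)
  obtain ⟨δ, hδ, hne⟩ := exists_pos_forall_ne_zero (l k)
  -- Near `0` the limit `z` is squeezed between the modulus of the characteristic function of `l k`
  -- and `1`.
  have hcont : ContinuousAt z 0 := by
    rw [ContinuousAt, hz0]
    have hlow : Tendsto (fun t => ‖charFun (l k : Measure E) t‖) (𝓝 0) (𝓝 1) := by
      have := (continuous_charFun (μ := (l k : Measure E))).norm.tendsto 0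
      simpa using this
    refine tendsto_of_tendsto_of_tendsto_of_le_of_le' hlow tendsto_const_nhds ?_
      (Eventually.of_forall hz_le)
    filter_upwards [Metric.ball_mem_nhds (0 : E) hδ] with t ht
    exact ge_of_tendsto (hz t) (Eventually.of_forall fun n =>
      norm_charFun_le_re_partialConv hμ hl k (hne t (by simpa using ht)) n)
  obtain ⟨ρ, hρ⟩ := ProbabilityMeasure.exists_charFun_eq_of_tendsto
    (Complex.continuous_ofReal.continuousAt.comp hcont) hz'
  refine ⟨ρ, ProbabilityMeasure.tendsto_of_tendsto_charFun fun t => ?_⟩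
  rw [hρ]
  exact hz' t

/-- If the convolution equation has a solution, it has a symmetric solution which is asymptotically
negligible under the powers of `Φ`. -/
lemma exists_symmetric_solution (hμ : ∀ k, IsSymmetric (μ k))
    (hl : ∀ k, l k = conv (μ k) (image Φ (l (k - 1)))) :
    ∃ ρ : ℤ → ProbabilityMeasure E, (∀ k, ρ k = conv (μ k) (image Φ (ρ (k - 1)))) ∧
      (∀ k, IsSymmetric (ρ k)) ∧
      ∀ k, Tendsto (fun n : ℕ => image (Φ ^ n) (ρ (k - n))) atTop (𝓝 (diracProba 0)) := by
  choose ρ hρ using exists_tendsto_partialConv hμ hl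
  have hchar (k : ℤ) (t : E) := ProbabilityMeasure.tendsto_iff_tendsto_charFun.1 (hρ k) t
  refine ⟨ρ, fun k => ProbabilityMeasure.eq_of_charFun_eq fun t => ?_, fun k => ?_,
    fun k => ?_⟩
  · rw [charFun_conv_coe, charFun_image]
    refine tendsto_nhds_unique ((tendsto_add_atTop_iff_nat 1).2 (hchar k t)) ?_
    simp_rw [charFun_partialConv_succ]
    exact (hchar (k - 1) _).const_mul _
  · refine (isSymmetric_iff_conj_charFun _).2 fun t => ?_
    refine tendsto_nhds_unique ((Complex.continuous_conj.tendsto _).comp (hchar k t)) ?_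
    refine (hchar k t).congr fun n => ?_
    exact (conj_charFun_partialConv hμ n k t).symm
  · refine ProbabilityMeasure.tendsto_of_tendsto_charFun fun t => ?_
    have hadj (n : ℕ) : (Φ ^ n).adjoint = Φ.adjoint ^ n := by
      simp only [← ContinuousLinearMap.star_eq_adjoint, star_pow]
    simp_rw [charFun_image, hadj]
    have him (n : ℕ) : ((charFun (ρ (k - n) : Measure E) ((Φ.adjoint ^ n) t)).re : ℂ) =
        charFun (ρ (k - n) : Measure E) ((Φ.adjoint ^ n) t) := by
      refine tendsto_nhds_unique ((Complex.continuous_ofReal.comp Complex.continuous_re).tendsto _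
        |>.comp (hchar (k - n) _)) ?_
      refine (hchar (k - n) _).congr fun m => ?_
      exact (ofReal_re_charFun_partialConv hμ m _ _).symm
    have hre : Tendsto (fun n : ℕ => (charFun (ρ (k - n) : Measure E) ((Φ.adjoint ^ n) t)).re)
        atTop (𝓝 1) := by
      rw [Metric.tendsto_atTop]
      intro ε hε
      obtain ⟨N, hN⟩ := blocksTendToOne hμ hl k t (ε / 2) (by positivity)
      refine ⟨N, fun n hn => ?_⟩
      -- Since `N` does not depend on `m`, the block bound survives `m → ∞`.
      have h1 : 1 - (charFun (ρ (k - n) : Measure E) ((Φ.adjoint ^ n) t)).re ≤ ε / 2 :=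
        le_of_tendsto (((Complex.continuous_re.tendsto _).comp (hchar (k - n) _)).const_sub 1)
          (Eventually.of_forall fun m => hN n hn m)
      have h2 := re_charFun_le_one (ρ (k - n) : Measure E) ((Φ.adjoint ^ n) t)
      rw [dist_comm, Real.dist_eq, abs_of_nonneg (sub_nonneg.2 h2)]
      linarith
    have hlim := ((Complex.continuous_ofReal.tendsto _).comp hre).congr him
    simpa [diracProba] using hlim

end PartialConv

/-! ### Convolution of product measures. -/

lemma measure_conv_apply {Y : Type*} [MeasurableSpace Y] [AddMonoid Y] [MeasurableAdd₂ Y]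
    (α β : Measure Y) [SFinite β] {A : Set Y} (hA : MeasurableSet A) :
    Measure.conv α β A = ∫⁻ x, β ((fun y => x + y) ⁻¹' A) ∂α := by
  rw [Measure.conv, Measure.map_apply measurable_add hA, Measure.prod_apply (measurable_add hA)]
  rfl

section Product

variable {ι : Type*} {X : ι → Type*} [∀ i, MeasurableSpace (X i)] [∀ i, AddMonoid (X i)]
  [∀ i, MeasurableAdd₂ (X i)]

/-- The convolution of product measures is the product of the convolutions. -/
lemma infinitePi_conv_infinitePi [Countable ι] (μ ν : (i : ι) → Measure (X i))
    [∀ i, IsProbabilityMeasure (μ i)] [∀ i, IsProbabilityMeasure (ν i)] :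
    Measure.conv (Measure.infinitePi μ) (Measure.infinitePi ν) =
      Measure.infinitePi fun i => Measure.conv (μ i) (ν i) := by
  refine Measure.eq_infinitePi _ fun s t ht => ?_
  have hmeas (i : ι) : Measurable fun x : X i => ν i ((fun y => x + y) ⁻¹' t i) :=
    measurable_measure_prodMk_left (measurable_add (ht i))
  rw [measure_conv_apply _ _ (.pi s.countable_toSet fun i _ => ht i)]
  have hpre (x : ∀ i, X i) : Measure.infinitePi ν ((fun y => x + y) ⁻¹' (s : Set ι).pi t) =
      ∏ i ∈ s, ν i ((fun y => x i + y) ⁻¹' t i) := by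
    rw [← Measure.infinitePi_pi ν fun i _ => measurable_const_add (x i) (ht i)]
    rfl
  simp_rw [hpre]
  -- Independence of the coordinates turns the integral of the finite product into a product of
  -- integrals.
  have hind := (ProbabilityTheory.iIndepFun_infinitePi (P := μ) hmeas)
  rw [ProbabilityTheory.lintegral_prod_eq_prod_lintegral_of_indepFun s _ hind
    (fun i => (hmeas i).comp (measurable_pi_apply i))]
  refine Finset.prod_congr rfl fun i _ => ?_
  rw [measure_conv_apply _ _ (ht i),
    ← lintegral_map (hmeas i) (measurable_pi_apply i), Measure.infinitePi_map_eval]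

end Product

/-! ### Weak convergence to a point mass in a countable product. -/

section Weak

/-- Weak convergence to a Dirac mass in a countable product may be checked on coordinates. -/
lemma tendsto_diracProba_pi {ι : Type*} [Countable ι] {E : Type*} [PseudoMetricSpace E]
    [SecondCountableTopology E] [MeasurableSpace E] [BorelSpace E]
    {ν : ℕ → ProbabilityMeasure (ι → E)} {c : ι → E}
    (h : ∀ i, Tendsto (fun n => (ν n).map (f := fun x => x i) (measurable_pi_apply i).aemeasurable)
      atTop (𝓝 (diracProba (c i)))) :
    Tendsto ν atTop (𝓝 (diracProba c)) := by
  refine tendsto_of_forall_isOpen_le_liminf' fun G hG => ?_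
  by_cases hc : c ∈ G
  swap
  · simp [diracProba, Measure.dirac_apply' _ hG.measurableSet, hc]
  obtain ⟨s, u, hu, hsub⟩ := isOpen_pi_iff.1 hG c hc
  have hone (i : ι) (hi : i ∈ s) :
      Tendsto (fun n => (ν n : Measure (ι → E)) {x | x i ∈ (u i)ᶜ}) atTop (𝓝 0) := by
    have hle := ProbabilityMeasure.limsup_measure_closed_le_of_tendsto (h i)
      (hu i hi).1.isClosed_compl
    have hz : ((diracProba (c i) : ProbabilityMeasure E) : Measure E) (u i)ᶜ = 0 := by
      simp [diracProba, Measure.dirac_apply' _ (hu i hi).1.measurableSet.compl, (hu i hi).2]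
    rw [hz] at hle
    refine tendsto_of_le_liminf_of_limsup_le zero_le ?_
    refine le_of_eq_of_le (congrArg (fun w : ℕ → ENNReal => limsup w atTop) ?_) hle
    ext n
    rw [ProbabilityMeasure.toMeasure_map, Measure.map_apply (measurable_pi_apply i)
      (hu i hi).1.measurableSet.compl]
    rfl
  have hsum : Tendsto (fun n => 1 - ∑ i ∈ s, (ν n : Measure (ι → E)) {x | x i ∈ (u i)ᶜ})
      atTop (𝓝 1) := by
    have := ENNReal.Tendsto.sub (tendsto_const_nhds (x := (1 : ENNReal)) (f := atTop))
      (tendsto_finsetSum s hone) (by simp)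
    simpa using this
  -- Union bound: a point outside the open set `G` leaves the basic box around `c` in some
  -- coordinate of `s`.
  have hle (n : ℕ) : 1 - ∑ i ∈ s, (ν n : Measure (ι → E)) {x | x i ∈ (u i)ᶜ} ≤
      (ν n : Measure (ι → E)) G := by
    rw [tsub_le_iff_left, ← measure_univ (μ := (ν n : Measure (ι → E)))]
    calc (ν n : Measure (ι → E)) Set.univ
        ≤ (ν n : Measure (ι → E)) ((⋃ i ∈ s, {x | x i ∈ (u i)ᶜ}) ∪ G) := by
          refine measure_mono fun x _ => ?_
          by_cases hx : ∀ i ∈ s, x i ∈ u i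
          · exact Or.inr (hsub hx)
          · push Not at hx
            obtain ⟨i, hi, hxi⟩ := hx
            exact Or.inl (Set.mem_biUnion (x := i) hi hxi)
      _ ≤ _ := (measure_union_le _ _).trans
          (add_le_add_left (measure_biUnion_finset_le s _) _)
  calc (diracProba c : Measure (ι → E)) G ≤ 1 := prob_le_one
    _ = liminf (fun n => 1 - ∑ i ∈ s, (ν n : Measure (ι → E)) {x | x i ∈ (u i)ᶜ}) atTop :=
      hsum.liminf_eq.symm
    _ ≤ _ := liminf_le_liminf (Eventually.of_forall hle)

end Weak

/-! ### Marginals and products of laws on bi-sequences. -/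

section Marginals

variable {d : ℕ}

lemma weightedShift_pow_apply
    (φ : EuclideanSpace ℝ (Fin d) →ₗ[ℝ] EuclideanSpace ℝ (Fin d)) (n : ℕ)
    (v : ℤ → EuclideanSpace ℝ (Fin d)) (k : ℤ) :
    (weightedShift φ ^ n) v k = (φ.toContinuousLinearMap ^ n) (v (k - n)) := by
  induction n generalizing k with
  | zero => simp
  | succ n ih =>
    rw [pow_succ', pow_succ', Nat.cast_succ, add_comm (n : ℤ) 1, ← sub_sub]
    exact congrArg φ.toContinuousLinearMap (ih (k - 1))

/-- The `k`-th marginal law of a measure on bi-sequences. -/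
noncomputable def marginal (k : ℤ) (ρ : ProbabilityMeasure (ℤ → EuclideanSpace ℝ (Fin d))) :
    ProbabilityMeasure (EuclideanSpace ℝ (Fin d)) :=
  ρ.map (f := fun x => x k) (measurable_pi_apply k).aemeasurable

lemma marginal_productLaw (μ : ℤ → ProbabilityMeasure (EuclideanSpace ℝ (Fin d))) (k : ℤ) :
    marginal k (productLaw μ) = μ k :=
  Subtype.ext (Measure.infinitePi_map_eval _ k)

lemma marginal_conv (ρ₁ ρ₂ : ProbabilityMeasure (ℤ → EuclideanSpace ℝ (Fin d))) (k : ℤ) :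
    marginal k (conv ρ₁ ρ₂) = conv (marginal k ρ₁) (marginal k ρ₂) :=
  Subtype.ext (Measure.map_conv_addMonoidHom
    (Pi.evalAddMonoidHom (fun _ : ℤ => EuclideanSpace ℝ (Fin d)) k) (measurable_pi_apply k))

lemma marginal_image_weightedShift_pow
    (φ : EuclideanSpace ℝ (Fin d) →ₗ[ℝ] EuclideanSpace ℝ (Fin d)) (n : ℕ)
    (ρ : ProbabilityMeasure (ℤ → EuclideanSpace ℝ (Fin d))) (k : ℤ) :
    marginal k (image (weightedShift φ ^ n) ρ) =
      image (φ.toContinuousLinearMap ^ n) (marginal (k - n) ρ) := by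
  have h₁ := Measure.map_map (μ := (ρ : Measure (ℤ → EuclideanSpace ℝ (Fin d))))
    (measurable_pi_apply k) (weightedShift φ ^ n).continuous.measurable
  have h₂ := Measure.map_map (μ := (ρ : Measure (ℤ → EuclideanSpace ℝ (Fin d))))
    (φ.toContinuousLinearMap ^ n).continuous.measurable (measurable_pi_apply (k - n))
  have hcomp : (fun x : ℤ → EuclideanSpace ℝ (Fin d) => x k) ∘ (weightedShift φ ^ n) =
      (φ.toContinuousLinearMap ^ n) ∘ fun x => x (k - n) :=
    funext fun v => weightedShift_pow_apply φ n v k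
  rw [hcomp, ← h₂] at h₁
  exact Subtype.ext h₁

lemma marginal_image_weightedShift
    (φ : EuclideanSpace ℝ (Fin d) →ₗ[ℝ] EuclideanSpace ℝ (Fin d))
    (ρ : ProbabilityMeasure (ℤ → EuclideanSpace ℝ (Fin d))) (k : ℤ) :
    marginal k (image (weightedShift φ) ρ) =
      image φ.toContinuousLinearMap (marginal (k - 1) ρ) := by
  simpa using marginal_image_weightedShift_pow φ 1 ρ k

lemma image_weightedShift_productLaw
    (φ : EuclideanSpace ℝ (Fin d) →ₗ[ℝ] EuclideanSpace ℝ (Fin d))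
    (ρ : ℤ → ProbabilityMeasure (EuclideanSpace ℝ (Fin d))) :
    image (weightedShift φ) (productLaw ρ) =
      productLaw fun k => image φ.toContinuousLinearMap (ρ (k - 1)) := by
  have hshift : (Measure.infinitePi fun k => (ρ k : Measure (EuclideanSpace ℝ (Fin d)))).map
      (fun ω k => ω (k - 1)) =
      Measure.infinitePi fun k => (ρ (k - 1) : Measure (EuclideanSpace ℝ (Fin d))) :=
    Measure.map_infinitePi_infinitePi_of_inj (sub_left_injective (b := (1 : ℤ)))
  have hmap := Measure.infinitePi_map_pi
    (fun k => (ρ (k - 1) : Measure (EuclideanSpace ℝ (Fin d))))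
    (f := fun _ => φ.toContinuousLinearMap) (fun _ => by fun_prop)
  rw [← hshift, Measure.map_map (by fun_prop) (by fun_prop)] at hmap
  exact Subtype.ext hmap

lemma conv_productLaw (μ ν : ℤ → ProbabilityMeasure (EuclideanSpace ℝ (Fin d))) :
    conv (productLaw μ) (productLaw ν) = productLaw fun k => conv (μ k) (ν k) :=
  Subtype.ext (infinitePi_conv_infinitePi _ _)

lemma isSymmetric_productLaw {ρ : ℤ → ProbabilityMeasure (EuclideanSpace ℝ (Fin d))}
    (hρ : ∀ k, IsSymmetric (ρ k)) : IsSymmetric (productLaw ρ) := by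
  have h := Measure.infinitePi_map_pi (fun k => (ρ k : Measure (EuclideanSpace ℝ (Fin d))))
    (f := fun _ x => -x) (fun _ => measurable_neg)
  have hneg (k : ℤ) : (ρ k : Measure (EuclideanSpace ℝ (Fin d))).map (fun x => -x) = ρ k := hρ k
  simp only [hneg] at h
  exact h

end Marginals

end OpDecomp

theorem mainTheorem6 (d : ℕ)
    (μ : ℤ → MeasureTheory.ProbabilityMeasure (EuclideanSpace ℝ (Fin d)))
    (φ : EuclideanSpace ℝ (Fin d) →ₗ[ℝ] EuclideanSpace ℝ (Fin d))
    (hφ : Function.Bijective φ)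
    (hμ : ∀ k : ℤ, OpDecomp.IsSymmetric (μ k)) :
    (∃ l : ℤ → MeasureTheory.ProbabilityMeasure (EuclideanSpace ℝ (Fin d)),
        OpDecomp.IsSolution μ φ l) ↔
      ∃ ρ : MeasureTheory.ProbabilityMeasure (ℤ → EuclideanSpace ℝ (Fin d)),
        OpDecomp.IsSymmetric ρ ∧
        OpDecomp.IsStronglyDecomposable (OpDecomp.weightedShift φ) ρ
          (OpDecomp.productLaw μ) := by
  constructor
  · rintro ⟨l, hl⟩
    obtain ⟨ρ, hρ, hsymm, htend⟩ := OpDecomp.exists_symmetric_solution hμ hl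
    refine ⟨OpDecomp.productLaw ρ, OpDecomp.isSymmetric_productLaw hsymm, ?_, ?_⟩
    · rw [OpDecomp.IsDecomposable, OpDecomp.image_weightedShift_productLaw, OpDecomp.conv_productLaw]
      exact congrArg OpDecomp.productLaw (funext hρ)
    · refine OpDecomp.tendsto_diracProba_pi fun k => ?_
      refine (htend k).congr fun n => ?_
      rw [← OpDecomp.marginal_productLaw ρ (k - n), ← OpDecomp.marginal_image_weightedShift_pow]
      rfl
  · rintro ⟨ρ, -, hdec, -⟩
    refine ⟨fun k => OpDecomp.marginal k ρ, fun k => ?_⟩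
    rw [← OpDecomp.marginal_image_weightedShift, ← OpDecomp.marginal_productLaw μ k,
      ← OpDecomp.marginal_conv, ← hdec]
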